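/- Let $R$ be a unital ring (not necessarily commutative), and let $\mathcal{B}$ be an additive full subcategory of the category of finitely presented left $R$-modules. Write $\varinjlim\mathcal{B}$ for the class of left $R$-modules that are colimits of (small) filtered diagrams of modules from $\mathcal{B}$, and write $(\mathrm{Mod}\text{-}R)^{\mathcal{B}}$ for the class of right $R$-modules that are direct summands of (arbitrary, set-indexed) products of right $R$-modules of the form $\operatorname{Hom}_{\mathbb{Z}}(B,\mathbb{Q}/\mathbb{Z})$ with $B\in\mathcal{B}$. Call $R$ $\mathcal{B}$-coherent if $\varinjlim\mathcal{B}$ is closed under arbitrary products in the category of left $R$-modules. Assume that the left $R$-module $R$ belongs to $\varinjlim\mathcal{B}$ and that $R$ is $\mathcal{B}$-coherent. Then for every right $R$-module $E$ in $(\mathrm{Mod}\text{-}R)^{\mathcal{B}}$, the left $R$-module $\operatorname{Hom}_{\mathbb{Z}}(E,\mathbb{Q}/\mathbb{Z})$ belongs to $\varinjlim\mathcal{B}$. -/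

import Mathlib

open CategoryTheory CategoryTheory.Limits

universe u

/-- The right `R`-module structure on `Hom_ℤ(M, ℚ/ℤ)` for a left `R`-module `M`:
`(f · r)(m) = f (r m)`. Right `R`-modules are left modules over `Rᵐᵒᵖ`. -/
instance characterModuleRight (R : Type u) [Ring R] (M : Type u) [AddCommGroup M]
    [Module R M] : Module Rᵐᵒᵖ (CharacterModule M) where
  smul r f := AddMonoidHom.comp (f : M →+ AddCircle (1 : ℚ))
    (DistribSMul.toAddMonoidHom M r.unop)
  one_smul f := by
    refine CharacterModule.ext _ fun m => ?_
    change f ((1 : R) • m) = f m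
    rw [one_smul]
  mul_smul r s f := by
    refine CharacterModule.ext _ fun m => ?_
    change f ((s.unop * r.unop) • m) = f (s.unop • r.unop • m)
    rw [mul_smul]
  smul_zero _ := rfl
  smul_add _ _ _ := rfl
  add_smul r s f := by
    refine CharacterModule.ext _ fun m => ?_
    change f ((r.unop + s.unop) • m) = f (r.unop • m) + f (s.unop • m)
    rw [add_smul, map_add]
  zero_smul f := by
    refine CharacterModule.ext _ fun m => ?_
    change f ((0 : R) • m) = 0
    rw [zero_smul, map_zero]

/-- The left `R`-module structure on `Hom_ℤ(E, ℚ/ℤ)` for a right `R`-module `E`: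
`(r · f)(e) = f (e r)`. -/
instance characterModuleLeft (R : Type u) [Ring R] (E : Type u) [AddCommGroup E]
    [Module Rᵐᵒᵖ E] : Module R (CharacterModule E) where
  smul r f := AddMonoidHom.comp (f : E →+ AddCircle (1 : ℚ))
    (DistribSMul.toAddMonoidHom E (MulOpposite.op r))
  one_smul f := by
    refine CharacterModule.ext _ fun m => ?_
    change f ((1 : Rᵐᵒᵖ) • m) = f m
    rw [one_smul]
  mul_smul r s f := by
    refine CharacterModule.ext _ fun m => ?_
    change f ((MulOpposite.op s * MulOpposite.op r) • m)
      = f (MulOpposite.op s • MulOpposite.op r • m)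
    rw [mul_smul]
  smul_zero _ := rfl
  smul_add _ _ _ := rfl
  add_smul r s f := by
    refine CharacterModule.ext _ fun m => ?_
    change f ((MulOpposite.op r + MulOpposite.op s) • m)
      = f (MulOpposite.op r • m) + f (MulOpposite.op s • m)
    rw [add_smul, map_add]
  zero_smul f := by
    refine CharacterModule.ext _ fun m => ?_
    change f ((0 : Rᵐᵒᵖ) • m) = 0
    rw [zero_smul, map_zero]

/-- The right `R`-module `Hom_ℤ(M, ℚ/ℤ)` of a left `R`-module `M`. -/
def rightDual {R : Type u} [Ring R] (M : ModuleCat.{u} R) : ModuleCat.{u} Rᵐᵒᵖ :=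
  ModuleCat.of Rᵐᵒᵖ (CharacterModule M)

/-- The left `R`-module `Hom_ℤ(E, ℚ/ℤ)` of a right `R`-module `E`. -/
def leftDual {R : Type u} [Ring R] (E : ModuleCat.{u} Rᵐᵒᵖ) : ModuleCat.{u} R :=
  ModuleCat.of R (CharacterModule E)

/-- `lim→ 𝓑`: the modules that are colimits of small filtered diagrams of modules from `𝓑`. -/
def limClosure {R : Type u} [Ring R] (𝓑 : ObjectProperty (ModuleCat.{u} R)) :
    ObjectProperty (ModuleCat.{u} R) :=
  ObjectProperty.ind.{u} 𝓑

/-- `Prod 𝓒`: the direct summands of arbitrary products of modules from `𝓒`. -/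
def prodClosure {S : Type u} [Ring S] (𝓒 : ObjectProperty (ModuleCat.{u} S)) :
    ObjectProperty (ModuleCat.{u} S) := fun M =>
  ∃ (ι : Type u) (C : ι → ModuleCat.{u} S), (∀ i, 𝓒 (C i)) ∧
    Nonempty (Retract M (ModuleCat.of S (∀ i, C i)))

/-- `(Mod-R)^𝓑`, the right `R`-modules with cosupport in `𝓑`:
`Prod { Hom_ℤ(B, ℚ/ℤ) | B ∈ 𝓑 }`. -/
def cosupported {R : Type u} [Ring R] (𝓑 : ObjectProperty (ModuleCat.{u} R)) :
    ObjectProperty (ModuleCat.{u} Rᵐᵒᵖ) :=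
  prodClosure fun N => ∃ B, 𝓑 B ∧ N = rightDual B

/-- `R` is `𝓑`-coherent: `lim→ 𝓑` is closed under arbitrary products in `R-Mod`. -/
def IsCoherentRel {R : Type u} [Ring R] (𝓑 : ObjectProperty (ModuleCat.{u} R)) : Prop :=
  ∀ (ι : Type u) (M : ι → ModuleCat.{u} R), (∀ i, limClosure 𝓑 (M i)) →
    limClosure 𝓑 (ModuleCat.of R (∀ i, M i))

/-! Write `*` for the character dual. Since `∏ Bᵢ*` is `(⨁ Bᵢ)*`, a module `E` with cosupport in `𝓑`
is a summand of `(⨁ Bᵢ)*`, so `E*` is a summand of `(⨁ Bᵢ)**`. By Lenzing's criterion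
(`limClosure_iff`), `lim→ 𝓑` contains `⨁ Bᵢ` and is closed under summands; what remains is closure
under double duals.

This is where coherence enters. Applying the criterion to the map from a finitely presented `F` to
the product of all its targets in `𝓑` gives `u : F → W` with `W` in `𝓑`, through which every map
from `F` to `𝓑` factors (`exists_approximation`). For `M` in `lim→ 𝓑`, the map `Hom(W, M) → Hom(F,
M)` is therefore onto, and it stays onto after double dualization. As `Hom(F, M)** → Hom(F, M**)` is
onto for `F` finitely presented (`bidualHom_surjective`), every map `F → M**` extends along `u`, and
the criterion applies to `M**`. -/

section

/-! ### Finitely presented modules are the finitely presentable objects -/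

variable (R : Type u) [Ring R]

/-- The finitely presented modules, as a property of objects of `ModuleCat R`. -/
def finitelyPresentedModules : ObjectProperty (ModuleCat.{u} R) :=
  fun M => Module.FinitePresentation R M

instance : (finitelyPresentedModules R).IsClosedUnderIsomorphisms where
  of_iso e h := by
    have : Module.FinitePresentation R _ := h
    exact Module.FinitePresentation.of_equiv e.toLinearEquiv

variable {R}

lemma finitelyPresentedModules_isClosedUnderColimitsOfShape (J : Type u) [SmallCategory J]
    [Finite (Arrow J)] : (finitelyPresentedModules R).IsClosedUnderColimitsOfShape J where
  colimitsOfShape_le := by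
    classical
    rintro X ⟨h⟩
    have : Finite J := Finite.of_injective (fun j : J => Arrow.mk (𝟙 j)) fun j k hjk =>
      congrArg Comma.left hjk
    have := Fintype.ofFinite J
    have hF : ∀ j, Module.FinitePresentation R (h.diag.obj j) := h.prop_diag_obj
    let q : ∀ j, h.diag.obj j →ₗ[R] X := fun j => (h.ι.app j).hom
    let p : (∀ j, h.diag.obj j) →ₗ[R] X := LinearMap.lsum R (fun j => h.diag.obj j) ℕ q
    have hp : ∀ j (x : h.diag.obj j), p (Pi.single j x) = (h.ι.app j).hom x := by
      intro j x
      exact LinearMap.lsum_piSingle (S := ℕ) (f := q) (i := j) (x := x)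
    -- The colimit is the sum of the `h.diag.obj j` modulo the relations `K`. There are finitely
    -- many arrows, each with a finitely generated source, so `K` is finitely generated.
    let L : ∀ a : Arrow J, h.diag.obj a.left →ₗ[R] ∀ j, h.diag.obj j := fun a =>
      LinearMap.single R (fun j => h.diag.obj j) a.right ∘ₗ (h.diag.map a.hom).hom -
        LinearMap.single R (fun j => h.diag.obj j) a.left
    let K : Submodule R (∀ j, h.diag.obj j) := ⨆ a, LinearMap.range (L a)
    have hK : K.FG := Submodule.fg_iSup _ fun a => by
      have := hF a.left
      exact Module.Finite.iff_fg.1 inferInstance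
    have hKp : K ≤ LinearMap.ker p := by
      refine iSup_le fun a => ?_
      rintro _ ⟨x, rfl⟩
      have := LinearMap.congr_fun (congrArg ModuleCat.Hom.hom (h.ι.naturality a.hom)) x
      simp only [L, LinearMap.mem_ker, LinearMap.sub_apply, map_sub, LinearMap.comp_apply,
        LinearMap.coe_single, hp]
      exact sub_eq_zero.2 this
    let c : Cocone h.diag :=
      { pt := ModuleCat.of R ((∀ j, h.diag.obj j) ⧸ K)
        ι :=
          { app := fun j => ModuleCat.ofHom
              (K.mkQ ∘ₗ LinearMap.single R (fun j => h.diag.obj j) j)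
            naturality := fun j k f => by
              ext x
              refine (Submodule.Quotient.eq K).2 ?_
              exact Submodule.mem_iSup_of_mem (Arrow.mk f) ⟨x, rfl⟩ } }
    let d : X ⟶ c.pt := h.isColimit.desc c
    have hd : ∀ j, h.ι.app j ≫ d = c.ι.app j := h.isColimit.fac c
    have hdp : d.hom ∘ₗ p = K.mkQ := by
      refine LinearMap.pi_ext' fun j => LinearMap.ext fun x => ?_
      change d.hom (p (Pi.single j x)) = K.mkQ (Pi.single j x)
      rw [hp]
      exact LinearMap.congr_fun (congrArg ModuleCat.Hom.hom (hd j)) x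
    have hsurj : Function.Surjective p := by
      have hed : d ≫ (ModuleCat.ofHom (K.liftQ p hKp) : c.pt ⟶ X) = 𝟙 X := by
        refine h.isColimit.hom_ext fun j => ModuleCat.hom_ext (LinearMap.ext fun x => ?_)
        have h1 := LinearMap.congr_fun (congrArg ModuleCat.Hom.hom (hd j)) x
        change d.hom ((h.ι.app j).hom x) = K.mkQ (Pi.single j x) at h1
        change K.liftQ p hKp (d.hom ((h.ι.app j).hom x)) = (h.ι.app j).hom x
        rw [h1]
        exact hp j x
      intro x
      obtain ⟨y, hy⟩ := K.mkQ_surjective (d.hom x)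
      refine ⟨y, ?_⟩
      have h1 := LinearMap.congr_fun (congrArg ModuleCat.Hom.hom hed) x
      change K.liftQ p hKp (d.hom x) = x at h1
      rw [← h1, ← hy]
      rfl
    have hker : LinearMap.ker p = K := by
      refine le_antisymm (fun y hy => ?_) hKp
      have h1 := LinearMap.congr_fun hdp y
      rw [LinearMap.comp_apply, LinearMap.mem_ker.1 hy, map_zero] at h1
      exact (Submodule.Quotient.mk_eq_zero K).1 h1.symm
    exact Module.finitePresentation_of_surjective p hsurj (hker ▸ hK)

attribute [local instance] Cardinal.fact_isRegular_aleph0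

variable (R)

lemma isFinitelyPresentable_ring : IsFinitelyPresentable.{u} (ModuleCat.of R R) := by
  rw [isFinitelyPresentable_iff_preservesFilteredColimits]
  -- `Hom(R, -)` is the forgetful functor, which preserves filtered colimits.
  let α : forget (ModuleCat.{u} R) ≅ coyoneda.obj (Opposite.op (ModuleCat.of R R)) :=
    NatIso.ofComponents (fun M => Equiv.toIso
      { toFun := fun x => ModuleCat.ofHom (LinearMap.toSpanSingleton R M x)
        invFun := fun f => f.hom 1
        left_inv := fun x => by simp
        right_inv := fun f => ModuleCat.hom_ext (LinearMap.ext_ring (by simp)) }) fun {M N} f => by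
        ext x
        refine ModuleCat.hom_ext (LinearMap.ext_ring ?_)
        simp
  exact ⟨fun J _ _ => preservesColimitsOfShape_of_natIso α⟩

lemma isStrongGenerator_ring :
    (ObjectProperty.singleton (ModuleCat.of R R)).IsStrongGenerator := by
  rw [ObjectProperty.isStrongGenerator_iff]
  refine ⟨fun X Y f g h => ?_, fun X Y i _ h => ?_⟩
  · ext x
    have := h _ (by simp)
      (ModuleCat.ofHom (LinearMap.toSpanSingleton R X x))
    simpa using LinearMap.congr_fun (congrArg ModuleCat.Hom.hom this) 1
  · have : Epi i := by
      rw [ModuleCat.epi_iff_surjective]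
      intro y
      obtain ⟨f, hf⟩ := h _ (by simp)
        (ModuleCat.ofHom (LinearMap.toSpanSingleton R Y y))
      refine ⟨f.hom 1, ?_⟩
      simpa using LinearMap.congr_fun (congrArg ModuleCat.Hom.hom hf) 1
    exact isIso_of_mono_of_epi i

lemma singleton_ring_le_isFinitelyPresentable :
    ObjectProperty.singleton (ModuleCat.of R R) ≤
      ObjectProperty.isFinitelyPresentable.{u} (ModuleCat.{u} R) := by
  rintro _ ⟨⟩
  exact isFinitelyPresentable_ring R

instance ModuleCat.isLocallyFinitelyPresentable :
    IsLocallyFinitelyPresentable.{u} (ModuleCat.{u} R) :=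
  (IsCardinalLocallyPresentable.iff_exists_isStrongGenerator _ _).2
    ⟨_, inferInstance, isStrongGenerator_ring R, singleton_ring_le_isFinitelyPresentable R⟩

/-- Both classes are the closure of `R` under finite colimits: the left one because `R` is a
finitely presentable strong generator, the right one because a finitely presented module is a
cokernel of some `R^m → R^n`. This makes the categorical criterion for `ObjectProperty.ind`
available for modules. -/
lemma isFinitelyPresentable_eq_finitelyPresentedModules :
    ObjectProperty.isFinitelyPresentable.{u} (ModuleCat.{u} R) = finitelyPresentedModules R := by
  have key : ObjectProperty.isFinitelyPresentable.{u} (ModuleCat.{u} R) =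
      (ObjectProperty.singleton (ModuleCat.of R R)).colimitsCardinalClosure Cardinal.aleph0.{u} :=
    IsStrongGenerator.colimitsCardinalClosure_eq_isCardinalPresentable
      (isStrongGenerator_ring R) (singleton_ring_le_isFinitelyPresentable R)
  apply le_antisymm
  · rw [key]
    refine ObjectProperty.colimitsCardinalClosure_le _ _ (fun J _ hJ => ?_) ?_
    · have : Finite (Arrow J) := (hasCardinalLT_aleph0_iff _).1 hJ
      exact finitelyPresentedModules_isClosedUnderColimitsOfShape J
    · rintro _ ⟨⟩
      exact inferInstanceAs (Module.FinitePresentation R R)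
  · intro M hM
    have : Module.FinitePresentation R M := hM
    obtain ⟨n, m, π, g, hπ, hg⟩ := Module.FinitePresentation.exists_fin' R M
    rw [key]
    have hfree : ∀ k : ℕ, (ObjectProperty.singleton (ModuleCat.of R R)).colimitsCardinalClosure
        Cardinal.aleph0.{u} (ModuleCat.of R (Fin k → R)) := by
      intro k
      have := ObjectProperty.isClosedUnderColimitsOfShape_colimitsCardinalClosure
        (ObjectProperty.singleton (ModuleCat.of R R)) Cardinal.aleph0.{u} (Discrete (Fin k))
        (by rw [hasCardinalLT_aleph0_iff]; infer_instance)
      refine ObjectProperty.prop_of_iso _ (ModuleCat.biproductIsoPi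
        fun _ : Fin k => ModuleCat.of R R) ?_
      refine ObjectProperty.prop_of_isColimit _
        (biproduct.isColimit fun _ : Fin k => ModuleCat.of R R) fun j => ?_
      exact ObjectProperty.le_colimitsCardinalClosure _ _ _ (by simp)
    have := ObjectProperty.isClosedUnderColimitsOfShape_colimitsCardinalClosure
        (ObjectProperty.singleton (ModuleCat.of R R)) Cardinal.aleph0.{u} WalkingParallelPair
        (by rw [hasCardinalLT_aleph0_iff]; infer_instance)
    refine ObjectProperty.prop_of_isColimit _
      (ModuleCat.isColimitCokernelCofork (ModuleCat.ofHom g) (ModuleCat.ofHom π) hg hπ) ?_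
    rintro (_ | _)
    · exact hfree m
    · exact hfree n

end

/-! ### Characters and double duals of Hom groups -/

/-- `ℚ/ℤ` is injective: a character of `A` vanishing on the kernel of `p : A → B` comes from a
character of `B`. -/
lemma CharacterModule.exists_comp_eq {A B : Type*} [AddCommGroup A] [AddCommGroup B]
    (p : A →+ B) (θ : CharacterModule A) (h : ∀ a, p a = 0 → θ a = 0) :
    ∃ θ' : CharacterModule B, ∀ a, θ' (p a) = θ a := by
  let q : A →ₗ[ℤ] B := p.toIntLinearMap
  let t : A →ₗ[ℤ] AddCircle (1 : ℚ) := AddMonoidHom.toIntLinearMap θ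
  have hk : LinearMap.ker q ≤ LinearMap.ker t := fun a ha => h a ha
  let t₀ : LinearMap.range q →ₗ[ℤ] AddCircle (1 : ℚ) :=
    (LinearMap.ker q).liftQ t hk ∘ₗ q.quotKerEquivRange.symm.toLinearMap
  obtain ⟨θ', hθ'⟩ := CharacterModule.dual_surjective_of_injective (LinearMap.range q).subtype
    (Submodule.subtype_injective _) (t₀.toAddMonoidHom : CharacterModule (LinearMap.range q))
  refine ⟨θ', fun a => ?_⟩
  have h1 := DFunLike.congr_fun hθ' ⟨q a, LinearMap.mem_range_self q a⟩
  refine h1.trans ?_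
  change (LinearMap.ker q).liftQ t hk (q.quotKerEquivRange.symm ⟨q a, _⟩) = θ a
  rw [LinearMap.quotKerEquivRange_symm_apply_image q a (LinearMap.mem_range_self q a)]
  rfl

section

variable {R : Type u} [Ring R] {F W M : Type u} [AddCommGroup F] [Module R F]
  [AddCommGroup W] [Module R W] [AddCommGroup M] [Module R M]

/-- The character `a ↦ χ (a x)` of `Hom_R(F, M)`. -/
def CharacterModule.evalAt (χ : CharacterModule M) (x : F) : CharacterModule (F →ₗ[R] M) :=
  AddMonoidHom.comp (χ : M →+ AddCircle (1 : ℚ))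
    ((LinearMap.applyₗ' ℤ x : (F →ₗ[R] M) →ₗ[ℤ] M).toAddMonoidHom)

@[simp]
lemma CharacterModule.evalAt_apply (χ : CharacterModule M) (x : F) (a : F →ₗ[R] M) :
    CharacterModule.evalAt χ x a = χ (a x) := rfl

/-- The canonical map `Hom_R(W, M)** → Hom_R(W, M**)`. -/
def bidualHom (ξ : CharacterModule (CharacterModule (W →ₗ[R] M))) :
    W →ₗ[R] CharacterModule (CharacterModule M) where
  toFun x := AddMonoidHom.mk' (fun χ : CharacterModule M => ξ (CharacterModule.evalAt χ x))
    fun χ χ' => by rw [← map_add]; rfl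
  map_add' x y := by
    refine CharacterModule.ext _ fun χ => ?_
    change ξ _ = ξ _ + ξ _
    rw [← map_add]
    congr 1
    refine CharacterModule.ext _ fun a => ?_
    change χ (a (x + y)) = χ (a x) + χ (a y)
    rw [map_add, map_add]
  map_smul' r x := by
    refine CharacterModule.ext _ fun χ => ?_
    change ξ _ = ξ _
    congr 1
    refine CharacterModule.ext _ fun a => ?_
    change χ (a (r • x)) = χ (r • a x)
    rw [map_smul]

@[simp]
lemma bidualHom_apply (ξ : CharacterModule (CharacterModule (W →ₗ[R] M))) (x : W)
    (χ : CharacterModule M) : bidualHom ξ x χ = ξ (CharacterModule.evalAt χ x) := rfl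

/-- For `F` finitely presented, the canonical map `Hom_R(F, M)** → Hom_R(F, M**)` is onto. -/
lemma bidualHom_surjective [Module.FinitePresentation R F] :
    Function.Surjective (bidualHom (R := R) (W := F) (M := M)) := by
  classical
  intro f
  obtain ⟨n, m, π, g, hπ, hg⟩ := Module.FinitePresentation.exists_fin' R F
  let e : ∀ k : Fin n, Fin n → R := fun k => Pi.single k 1
  let e' : ∀ l : Fin m, Fin m → R := fun l => Pi.single l 1
  have he : ∀ y : Fin n → R, y = ∑ k, y k • e k := fun y => pi_eq_sum_univ' y
  -- Applying `Hom(-, M)` to the presentation `R^m → R^n → F → 0` identifies `Hom(F, M)` with the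
  -- kernel of `j : M^n → M^m`; only `ker j ≤ range i` is needed.
  let i : (F →ₗ[R] M) →+ (Fin n → M) := AddMonoidHom.mk' (fun a k => a (π (e k))) fun _ _ => rfl
  let j : (Fin n → M) →+ (Fin m → M) :=
    AddMonoidHom.mk' (fun v l => ∑ k, g (e' l) k • v k) fun v w => by
      funext l; simp [Finset.sum_add_distrib]
  have hij : ∀ v, j v = 0 → ∃ a, i a = v := by
    intro v hv
    let b : (Fin n → R) →ₗ[R] M := (LinearMap.lsum R (fun _ : Fin n => R) ℕ)
      fun k => LinearMap.toSpanSingleton R M (v k)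
    have hb : ∀ y, b y = ∑ k, y k • v k := fun y => by simp [b]
    have hbg : b ∘ₗ g = 0 := by
      ext l
      have := congrFun hv l
      simpa [hb, j, e'] using this
    have hker : LinearMap.ker π ≤ LinearMap.ker b := by
      intro y hy
      obtain ⟨z, rfl⟩ := (hg y).1 hy
      exact LinearMap.congr_fun hbg z
    refine ⟨(LinearMap.ker π).liftQ b hker ∘ₗ (π.quotKerEquivOfSurjective hπ).symm.toLinearMap, ?_⟩
    funext k
    change (LinearMap.ker π).liftQ b hker ((π.quotKerEquivOfSurjective hπ).symm (π (e k))) = v k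
    have : (π.quotKerEquivOfSurjective hπ).symm (π (e k)) = Submodule.Quotient.mk (e k) := by
      rw [LinearEquiv.symm_apply_eq]; rfl
    rw [this, Submodule.liftQ_apply, hb]
    simp [e, Pi.single_apply]
  -- Under `(M^n)** = (M**)^n`, this is the family of values of `f` on the generators of `F`.
  let η : CharacterModule (CharacterModule (Fin n → M)) :=
    ∑ k, AddMonoidHom.mk' (fun θ : CharacterModule (Fin n → M) =>
      f (π (e k)) (AddMonoidHom.comp (θ : (Fin n → M) →+ _) (AddMonoidHom.single (fun _ => M) k)))
      fun θ θ' => map_add (f (π (e k)))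
        (AddMonoidHom.comp (θ : (Fin n → M) →+ _) (AddMonoidHom.single (fun _ => M) k))
        (AddMonoidHom.comp (θ' : (Fin n → M) →+ _) (AddMonoidHom.single (fun _ => M) k))
  have hη : ∀ θ : CharacterModule (Fin n → M), η θ = ∑ k, f (π (e k))
      (AddMonoidHom.comp (θ : (Fin n → M) →+ _) (AddMonoidHom.single (fun _ => M) k)) := fun θ =>
    AddMonoidHom.finsetSum_apply _ _ _
  have hf : ∀ (y : Fin n → R) (χ : CharacterModule M),
      f (π y) χ = ∑ k, f (π (e k)) (MulOpposite.op (y k) • χ) := by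
    intro y χ
    conv_lhs => rw [he y]
    rw [map_sum, map_sum]
    refine (AddMonoidHom.finsetSum_apply _ _ _).trans (Finset.sum_congr rfl fun k _ => ?_)
    rw [map_smul, map_smul]
    rfl
  let iD : CharacterModule (Fin n → M) →+ CharacterModule (F →ₗ[R] M) :=
    (CharacterModule.dual i.toIntLinearMap).toAddMonoidHom
  -- `η` descends along `iD`: a `θ` killed by `iD` vanishes on `ker j`, hence has the form `θ' ∘ j`,
  -- and then `η θ` is a sum of values of `f` at the relations `π (g (e' l)) = 0`.
  obtain ⟨ξ, hξ⟩ := CharacterModule.exists_comp_eq iD η <| by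
    intro θ hθ
    obtain ⟨θ', hθ'⟩ := CharacterModule.exists_comp_eq j θ <| by
      intro v hv
      obtain ⟨a, rfl⟩ := hij v hv
      exact DFunLike.congr_fun hθ a
    let t : Fin m → CharacterModule M := fun l =>
      AddMonoidHom.comp (θ' : (Fin m → M) →+ _) (AddMonoidHom.single (fun _ => M) l)
    have h1 : ∀ k, AddMonoidHom.comp (θ : (Fin n → M) →+ _) (AddMonoidHom.single (fun _ => M) k) =
        ∑ l, (MulOpposite.op (g (e' l) k) • t l : CharacterModule M) := by
      intro k
      refine CharacterModule.ext _ fun x => ?_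
      refine Eq.trans ?_ (AddMonoidHom.finsetSum_apply _ _ _).symm
      change θ (Pi.single k x) = ∑ l, θ' (Pi.single l (g (e' l) k • x))
      rw [← hθ', ← map_sum]
      congr 1
      funext l
      simp [j, Pi.single_apply, Finset.sum_apply]
    rw [hη]
    simp only [h1, map_sum]
    rw [Finset.sum_comm]
    refine Finset.sum_eq_zero fun l _ => ?_
    rw [← hf, (hg (g (e' l))).2 ⟨_, rfl⟩, map_zero]
    rfl
  refine ⟨ξ, LinearMap.ext fun x => CharacterModule.ext _ fun χ => ?_⟩
  obtain ⟨y, rfl⟩ := hπ x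
  let θ : CharacterModule (Fin n → M) := AddMonoidHom.comp (χ : M →+ AddCircle (1 : ℚ))
    (AddMonoidHom.mk' (fun v : Fin n → M => ∑ k, y k • v k) fun v w => by
      simp [Finset.sum_add_distrib])
  have h2 : CharacterModule.evalAt χ (π y) = iD θ := by
    refine CharacterModule.ext _ fun a => ?_
    change χ (a (π y)) = χ (∑ k, y k • a (π (e k)))
    conv_lhs => rw [he y]
    simp
  rw [bidualHom_apply, h2, hξ, hη, hf]
  refine Finset.sum_congr rfl fun k _ => congrArg _ (CharacterModule.ext _ fun x => ?_)
  change χ (∑ l, y l • (Pi.single k x : Fin n → M) l) = χ (y k • x)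
  simp [Pi.single_apply]

/-- If every map from a finitely presented module `F` to `M` extends along `u : F → W`, then so
does every map from `F` to `M**`. -/
lemma exists_extension_bidual [Module.FinitePresentation R F] (u : F →ₗ[R] W)
    (hu : ∀ a : F →ₗ[R] M, ∃ b : W →ₗ[R] M, b ∘ₗ u = a)
    (f : F →ₗ[R] CharacterModule (CharacterModule M)) :
    ∃ f' : W →ₗ[R] CharacterModule (CharacterModule M), f' ∘ₗ u = f := by
  obtain ⟨ξ, rfl⟩ := bidualHom_surjective f
  let uS : (W →ₗ[R] M) →+ (F →ₗ[R] M) := AddMonoidHom.mk' (fun b => b ∘ₗ u) fun _ _ => rfl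
  let uD : CharacterModule (F →ₗ[R] M) →+ CharacterModule (W →ₗ[R] M) :=
    (CharacterModule.dual uS.toIntLinearMap).toAddMonoidHom
  -- Restriction `uS` is onto, so its dual `uD` is injective and `ξ` extends along it; naturality of
  -- `bidualHom` in `W` then finishes.
  obtain ⟨ξ', hξ'⟩ := CharacterModule.exists_comp_eq uD ξ <| by
    intro θ hθ
    have : θ = 0 := CharacterModule.ext _ fun a => by
      obtain ⟨b, rfl⟩ := hu a
      exact DFunLike.congr_fun hθ b
    rw [this, map_zero]
  refine ⟨bidualHom ξ', LinearMap.ext fun x => CharacterModule.ext _ fun χ => ?_⟩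
  exact hξ' (CharacterModule.evalAt χ x)

end

/-! ### Closure properties of `lim→ 𝓑` -/

section

variable {R : Type u} [Ring R] {𝓑 : ObjectProperty (ModuleCat.{u} R)}

/-- Lenzing's criterion: for a class `𝓑` of finitely presented modules, `M` is in `lim→ 𝓑` if and
only if every map to `M` from a finitely presented module factors through a module in `𝓑`. -/
lemma limClosure_iff (hfp : ∀ B : ModuleCat.{u} R, 𝓑 B → Module.FinitePresentation R B)
    (M : ModuleCat.{u} R) :
    limClosure 𝓑 M ↔ ∀ (F : ModuleCat.{u} R), Module.FinitePresentation R F → ∀ g : F ⟶ M,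
      ∃ (W : ModuleCat.{u} R) (u : F ⟶ W) (v : W ⟶ M), u ≫ v = g ∧ 𝓑 W := by
  have h : 𝓑 ≤ ObjectProperty.isFinitelyPresentable.{u} (ModuleCat.{u} R) := by
    rw [isFinitelyPresentable_eq_finitelyPresentedModules]
    exact hfp
  have h' : ∀ F : ModuleCat.{u} R, IsFinitelyPresentable.{u} F ↔ Module.FinitePresentation R F :=
    fun F => iff_of_eq
      (congrFun (isFinitelyPresentable_eq_finitelyPresentedModules R) F)
  refine (ObjectProperty.ind_iff_exists h).trans ⟨fun H F hF g => ?_, fun H F g hF => ?_⟩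
  · have := (h' F).2 hF
    exact H g
  · exact H F ((h' F).1 hF) g

/-- If `lim→ 𝓑` is closed under products, then every finitely presented module has a left
`𝓑`-approximation. -/
lemma IsCoherentRel.exists_approximation (hcoh : IsCoherentRel 𝓑)
    (hfp : ∀ B : ModuleCat.{u} R, 𝓑 B → Module.FinitePresentation R B)
    (F : ModuleCat.{u} R) (hF : Module.FinitePresentation R F) :
    ∃ (W : ModuleCat.{u} R) (u : F ⟶ W), 𝓑 W ∧
      ∀ (B : ModuleCat.{u} R), 𝓑 B → ∀ φ : F ⟶ B, ∃ v : W ⟶ B, u ≫ v = φ := by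
  have h : 𝓑 ≤ ObjectProperty.isFinitelyPresentable.{u} (ModuleCat.{u} R) := by
    rw [isFinitelyPresentable_eq_finitelyPresentedModules]
    exact hfp
  -- Representatives of the isomorphism classes in `𝓑` form a small set, so the product over all
  -- maps from `F` to them has an index type in `Type u`, as coherence requires.
  have : ObjectProperty.EssentiallySmall.{u} 𝓑 := ObjectProperty.EssentiallySmall.of_le h
  obtain ⟨Q, _, hQ, hQ'⟩ := ObjectProperty.EssentiallySmall.exists_small_le.{u} 𝓑
  let e := equivShrink.{u} (Subtype Q)
  let C : (Σ X : Shrink.{u} (Subtype Q), F ⟶ (e.symm X).1) → ModuleCat.{u} R :=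
    fun s => (e.symm s.1).1
  have hC : limClosure 𝓑 (ModuleCat.of R (∀ s, C s)) :=
    hcoh _ C fun s => ObjectProperty.le_ind 𝓑 _ (hQ _ (e.symm s.1).2)
  obtain ⟨W, u, v, huv, hW⟩ := (limClosure_iff hfp _).1 hC F hF
    (ModuleCat.ofHom (LinearMap.pi fun s => s.2.hom))
  refine ⟨W, u, hW, fun B hB φ => ?_⟩
  obtain ⟨X, hX, ⟨i⟩⟩ := hQ' B hB
  obtain ⟨X, rfl⟩ : ∃ Y, (e.symm Y).1 = X := ⟨e ⟨X, hX⟩, by simp⟩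
  refine ⟨v ≫ ModuleCat.ofHom (LinearMap.proj (φ := fun s => C s) ⟨X, φ ≫ i.hom⟩) ≫ i.inv, ?_⟩
  rw [reassoc_of% huv]
  ext x
  change i.inv.hom (i.hom.hom (φ.hom x)) = φ.hom x
  simp

/-- If `lim→ 𝓑` is closed under products, then it is closed under double duals. -/
lemma IsCoherentRel.limClosure_bidual (hcoh : IsCoherentRel 𝓑)
    (hfp : ∀ B : ModuleCat.{u} R, 𝓑 B → Module.FinitePresentation R B)
    (M : ModuleCat.{u} R) (hM : limClosure 𝓑 M) : limClosure 𝓑 (leftDual (rightDual M)) := by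
  rw [limClosure_iff hfp]
  intro F hF f
  obtain ⟨W, u, hW, hu⟩ := hcoh.exists_approximation hfp F hF
  obtain ⟨f', hf'⟩ := exists_extension_bidual (M := M) u.hom (fun a => by
    obtain ⟨B, p, q, hpq, hB⟩ := (limClosure_iff hfp M).1 hM F hF (ModuleCat.ofHom a)
    obtain ⟨v, rfl⟩ := hu B hB p
    exact ⟨(v ≫ q).hom, congrArg ModuleCat.Hom.hom ((Category.assoc _ _ _).symm.trans hpq)⟩) f.hom
  exact ⟨W, u, ModuleCat.ofHom f', ModuleCat.hom_ext hf', hW⟩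

lemma limClosure_of_retract (hfp : ∀ B : ModuleCat.{u} R, 𝓑 B → Module.FinitePresentation R B)
    {M N : ModuleCat.{u} R} (r : Retract M N) (hN : limClosure 𝓑 N) : limClosure 𝓑 M := by
  rw [limClosure_iff hfp] at hN ⊢
  intro F hF g
  obtain ⟨W, u, v, huv, hW⟩ := hN F hF (g ≫ r.i)
  exact ⟨W, u, v ≫ r.r, by rw [reassoc_of% huv]; simp, hW⟩

/-- Direct sums of modules from an additive class `𝓑` of finitely presented modules belong to
`lim→ 𝓑`. -/
lemma limClosure_directSum [HasFiniteBiproducts 𝓑.FullSubcategory]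
    (hfp : ∀ B : ModuleCat.{u} R, 𝓑 B → Module.FinitePresentation R B)
    {ι : Type u} (B : ι → ModuleCat.{u} R) (hB : ∀ i, 𝓑 (B i)) :
    limClosure 𝓑 (ModuleCat.of R (Π₀ i, B i)) := by
  classical
  rw [limClosure_iff hfp]
  intro F hF g
  obtain ⟨S, hS⟩ : (⊤ : Submodule R F).FG := Module.Finite.fg_top
  -- The finitely many generators of `F` have finite supports, so `g` lands in the sum over the
  -- finite set `s`.
  let s : Finset ι := S.biUnion fun x => DFinsupp.support (g.hom x)
  have hs : ∀ (x : F) (i : ι), i ∉ s → (g.hom x : Π₀ i, B i) i = 0 := by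
    intro x i hi
    have : (⊤ : Submodule R F) ≤
        LinearMap.ker (DFinsupp.lapply (R := R) (M := fun i => B i) i ∘ₗ g.hom) := by
      rw [← hS, Submodule.span_le]
      intro y hy
      by_contra hne
      exact hi (Finset.mem_biUnion.2 ⟨y, hy, DFinsupp.mem_support_iff.2 hne⟩)
    exact this (Submodule.mem_top (x := x))
  let b : s → 𝓑.FullSubcategory := fun i => ⟨B i, hB i⟩
  -- This biproduct lives in the full subcategory, so its underlying module lies in `𝓑`. Of its
  -- structure only the relations `hδ` between injections and projections are used.
  let W := ⨁ b
  let u : F ⟶ W.obj := ModuleCat.ofHom (∑ i : s, (biproduct.ι b i).hom.hom ∘ₗ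
    DFinsupp.lapply (R := R) (M := fun i => B i) i.1 ∘ₗ g.hom)
  let v : W.obj ⟶ ModuleCat.of R (Π₀ i, B i) := ModuleCat.ofHom (∑ i : s,
    DFinsupp.lsingle (R := R) (M := fun i => B i) i.1 ∘ₗ (biproduct.π b i).hom.hom)
  have hδ : ∀ (i j : s) (x : B i.1), (biproduct.π b j).hom.hom ((biproduct.ι b i).hom.hom x) =
      if h : i = j then h ▸ x else 0 := by
    intro i j x
    split_ifs with h
    · subst h
      have := congrArg (fun f => f.hom.hom x) (biproduct.ι_π_self b i)
      exact this
    · have := congrArg (fun f => f.hom.hom x) (biproduct.ι_π_ne b h)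
      exact this
  refine ⟨W.obj, u, v, ?_, W.property⟩
  refine ModuleCat.hom_ext (LinearMap.ext fun x => ?_)
  let y : Π₀ i, B i := g.hom x
  have hu : u.hom x = ∑ i : s, (biproduct.ι b i).hom.hom (y i.1) := LinearMap.sum_apply _ _ _
  have hπu : ∀ j : s, (biproduct.π b j).hom.hom (u.hom x) = y j.1 := by
    intro j
    rw [hu, map_sum, Finset.sum_eq_single j]
    · rw [hδ, dif_pos rfl]
    · intro i _ hij
      rw [hδ, dif_neg hij]
    · simp
  have hv : v.hom (u.hom x) = ∑ j : s, DFinsupp.single j.1 (y j.1) := by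
    refine (LinearMap.sum_apply _ _ _).trans (Finset.sum_congr rfl fun j _ => ?_)
    exact congrArg (DFinsupp.single j.1) (hπu j)
  change v.hom (u.hom x) = y
  rw [hv, Finset.sum_coe_sort s fun j => DFinsupp.single j (y j)]
  refine DFinsupp.ext fun k => ?_
  rw [DFinsupp.finsetSum_apply]
  by_cases hk : k ∈ s
  · rw [Finset.sum_eq_single_of_mem k hk fun j _ hjk => DFinsupp.single_eq_of_ne hjk.symm,
      DFinsupp.single_eq_same]
  · rw [hs x k hk]
    exact Finset.sum_eq_zero fun j hj => DFinsupp.single_eq_of_ne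
      (ne_of_mem_of_not_mem hj hk).symm

/-- A morphism of right modules induces a morphism of left modules between the duals. -/
def leftDualMap {E E' : ModuleCat.{u} Rᵐᵒᵖ} (f : E ⟶ E') : leftDual E' ⟶ leftDual E :=
  ModuleCat.ofHom
    { toFun := fun χ => (AddMonoidHom.comp (χ : E' →+ AddCircle (1 : ℚ))
        f.hom.toAddMonoidHom : CharacterModule E)
      map_add' := fun _ _ => rfl
      map_smul' := fun r χ => CharacterModule.ext _ fun e => by
        change χ (MulOpposite.op r • f.hom e) = χ (f.hom (MulOpposite.op r • e))
        rw [map_smul f.hom] }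

/-- Dualization sends retracts to retracts. -/
def leftDualRetract {E E' : ModuleCat.{u} Rᵐᵒᵖ} (r : Retract E E') :
    Retract (leftDual E) (leftDual E') where
  i := leftDualMap r.r
  r := leftDualMap r.i
  retract := ModuleCat.hom_ext <| LinearMap.ext fun χ => CharacterModule.ext _ fun e =>
    congrArg (fun y => (show CharacterModule E from χ) y)
      (LinearMap.congr_fun (congrArg ModuleCat.Hom.hom r.retract) e)

/-- The product of the duals of a family is a retract of the dual of its direct sum. -/
noncomputable def retractPiRightDual {ι : Type u} (B : ι → ModuleCat.{u} R) :
    Retract (ModuleCat.of Rᵐᵒᵖ (∀ i, rightDual (B i)))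
      (rightDual (ModuleCat.of R (Π₀ i, B i))) := by
  classical
  exact
  -- Characters of a direct sum are families of characters. The two maps are mutually inverse, but
  -- one composite suffices for a retract.
  { i := ModuleCat.ofHom
      { toFun := fun χ => (DFinsupp.liftAddHom (fun i => (χ i : B i →+ AddCircle (1 : ℚ))) :
          (Π₀ i, B i) →+ AddCircle (1 : ℚ))
        map_add' := fun χ χ' => (DFinsupp.liftAddHom (β := fun i => B i)).map_add _ _
        map_smul' := fun r χ => DFinsupp.addHom_ext fun i x => by
          change _ = DFinsupp.liftAddHom (fun i => (χ i : B i →+ AddCircle (1 : ℚ)))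
            (r.unop • DFinsupp.single i x)
          rw [← DFinsupp.single_smul]
          have h₁ := DFinsupp.liftAddHom_apply_single (β := fun i => B i)
            (fun i => ((r • χ) i : CharacterModule (B i))) i x
          have h₂ := DFinsupp.liftAddHom_apply_single (β := fun i => B i)
            (fun i => (χ i : CharacterModule (B i))) i (r.unop • x)
          exact h₁.trans h₂.symm }
    r := ModuleCat.ofHom
      { toFun := fun χ i => (AddMonoidHom.comp (χ : (Π₀ i, B i) →+ AddCircle (1 : ℚ))
          (DFinsupp.singleAddHom (fun i => B i) i) : CharacterModule (B i))
        map_add' := fun _ _ => rfl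
        map_smul' := fun r χ => funext fun i => CharacterModule.ext _ fun x => by
          change χ (r.unop • DFinsupp.single i x) = χ (DFinsupp.single i (r.unop • x))
          rw [DFinsupp.single_smul] }
    retract := ModuleCat.hom_ext <| LinearMap.ext fun χ => funext fun i =>
      DFinsupp.liftAddHom_comp_single (fun i => (χ i : B i →+ AddCircle (1 : ℚ))) i }

end

theorem mainTheorem6 {R : Type u} [Ring R] (𝓑 : ObjectProperty (ModuleCat.{u} R))
    [HasFiniteBiproducts 𝓑.FullSubcategory]
    (hfp : ∀ B : ModuleCat.{u} R, 𝓑 B → Module.FinitePresentation R B)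
    (hR : limClosure 𝓑 (ModuleCat.of R R))
    (hcoh : IsCoherentRel 𝓑)
    (E : ModuleCat.{u} Rᵐᵒᵖ) (hE : cosupported 𝓑 E) :
    limClosure 𝓑 (leftDual E) := by
  obtain ⟨ι, C, hC, ⟨r⟩⟩ := hE
  choose B hB hCB using hC
  obtain rfl : C = fun i => rightDual (B i) := funext hCB
  exact limClosure_of_retract hfp (leftDualRetract (r.trans (retractPiRightDual B)))
    (hcoh.limClosure_bidual hfp _ (limClosure_directSum hfp B hB))
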